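/- Let $f:\mathbb{R}^d\to\mathbb{R}$ be bounded below, let $L_1,L_3>0$, and suppose that $f$ is $L_1$-smooth and has $L_3$-Lipschitz third-order derivatives. Here $f$ has an $L$-Lipschitz $n$th derivative if it is $n$ times differentiable and, for every $x_0$ and every unit vector $\delta$, the function $h(\theta)=f(x_0+\theta\delta)$ satisfies $|h^{(n)}(\theta_1)-h^{(n)}(\theta_2)|\le L|\theta_1-\theta_2|$ for all $\theta_1,\theta_2$; $L_1$-smooth is the case $n=1$, $L=L_1$. Let $p_0\in\mathbb{R}^d$, $\Delta_f=f(p_0)-\inf_z f(z)$, and let $\epsilon>0$ satisfy $$\epsilon^{2/3}\le\min\Big\{\Delta_f^{1/2}L_3^{1/6},\ \frac{L_1}{8L_3^{1/3}}\Big\}.$$ Set $\alpha=2L_3^{1/3}\epsilon^{2/3}$ and $\eta=\sqrt{2\alpha/L_3}$. Then the method below, run from $p_0$ with parameters $L_1,\epsilon,\alpha,\eta$, terminates with a point $p_K$ such that $\|\nabla f(p_K)\|\le\epsilon$, after at most $$20\cdot\frac{\Delta_f L_1^{1/2}L_3^{1/6}}{\epsilon^{5/3}}\,\log\Big(\frac{500L_1\Delta_f}{\epsilon^2}\Big)$$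 gradient evaluations. This holds for every rule by which ties in $\arg\min$ over a finite list of points, and the index $j$ in (a), are chosen. Method. For $k=1,2,\ldots$: let $\hat f(x)=f(x)+\alpha\|x-p_{k-1}\|^2$ and run the monitored accelerated gradient descent described next on $\hat f$ with $y_0=p_{k-1}$, $\epsilon'=\epsilon/10$, $L=L_1+2\alpha$, $\sigma=\alpha$. If it returns no pair $(u,v)$, let $p_k=y_t$. Otherwise let $p_k$ be the better (in value of $f$) of $b^{(1)}$ and $b^{(2)}$, where (a) $b^{(1)}$ minimizes $f$ over $\{y_0,\ldots,y_t,c_j,q_j,u\}$, with $0\le j<t$ such that $v=x_j$, and $c_j=(y_j+y_{j-1})/2$, $q_j=-2y_j+3y_{j-1}$ if $j>0$, $c_j=q_j=y_0$ if $j=0$; (b) $b^{(2)}$ minimizes $f$ over $\{v-\eta\delta,\ u+\eta'\delta\}$, with $\delta=(u-v)/\|u-v\|$ and $\eta'=\sqrt{\eta(\eta+\|u-v\|)}-\|u-v\|$. Stop and return $p_k$ if $\|\nabla f(p_k)\|\le\epsilon$. Monitored accelerated gradient descent on a function $g$ with $y_0,\epsilon',L,\sigma$: let $\kappa=L/\sigma$,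 $\omega=\frac{\sqrt\kappa-1}{\sqrt\kappa+1}$, $x_0=y_0$. For $t=1,2,\ldots$: let $y_t=x_{t-1}-\frac1L\nabla g(x_{t-1})$, $x_t=y_t+\omega(y_t-y_{t-1})$, $z_t=y_t-\frac1L\nabla g(y_t)$, $\psi(z_t)=g(y_0)-g(z_t)+\frac\sigma2\|z_t-y_0\|^2$. If $g(y_t)>g(y_0)$ let $w_t=y_0$; otherwise, if $\|\nabla g(y_t)\|^2>2L\psi(z_t)e^{-t/\sqrt\kappa}$ let $w_t=z_t$. If $w_t$ was defined, return the points computed so far together with the first pair $(u,v)=(u,x_j)$ (for $j=0,\ldots,t-1$, and $u=y_j,w_t$ in this order) with $g(u)<g(x_j)+\nabla g(x_j)^T(u-x_j)+\frac\sigma2\|u-x_j\|^2$. If $w_t$ was not defined and $\|\nabla g(y_t)\|\le\epsilon'$, return the points computed so far, without a pair. Gradients of $g=\hat f$ at $x_0,\ldots,x_{t-1}$ and $y_1,\ldots,y_t$ are each evaluated once per run and stored, one evaluation of $\nabla\hat f(x)=\nabla f(x)+2\alpha(x-p_{k-1})$ counting as one gradient evaluation; the stopping test at $p_k$ counts as one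 more. -/

import Mathlib

noncomputable section

namespace GuiltyAGD

open scoped Gradient

/-! ### Smoothness -/

/-- `f` has an `L`-Lipschitz `n`-th derivative: `f` is `n` times (Fréchet) differentiable and the
`n`-th derivative of its restriction to any line, parametrized at unit speed, is `L`-Lipschitz. -/
def HasLipschitzNthDeriv {E : Type} [NormedAddCommGroup E] [NormedSpace ℝ E]
    (n : ℕ) (L : ℝ) (f : E → ℝ) : Prop :=
  (∀ m < n, Differentiable ℝ (iteratedFDeriv ℝ m f)) ∧
    ∀ x₀ δ : E, ‖δ‖ = 1 → ∀ θ₁ θ₂ : ℝ,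
      |iteratedDeriv n (fun θ : ℝ => f (x₀ + θ • δ)) θ₁ -
        iteratedDeriv n (fun θ : ℝ => f (x₀ + θ • δ)) θ₂| ≤ L * |θ₁ - θ₂|

/-! ### Possibly non-terminating computations that count gradient evaluations -/

/-- A deterministic, possibly non-terminating computation with result in `A`. It is undefined when
it does not terminate (or aborts); otherwise it yields its result together with the number of
gradient evaluations that were made. -/
structure Counted (A : Type) where
  run : Part (A × ℕ)

instance : Monad Counted where
  pure a := ⟨Part.some (a, 0)⟩
  bind m k := ⟨m.run.bind fun r => (k r.1).run.map fun r' => (r'.1, r.2 + r'.2)⟩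

/-- The computation `c` terminates with result `a` after exactly `N` gradient evaluations. -/
def Counted.Outputs {A : Type} (c : Counted A) (a : A) (N : ℕ) : Prop :=
  (a, N) ∈ c.run

/-- An optional value, without cost; the computation aborts if there is none. -/
def Counted.ofOption {A : Type} (o : Option A) : Counted A :=
  ⟨(Part.ofOption o).map fun a => (a, 0)⟩

/-- One pass of a loop, on pairs of a loop state and the number of gradient evaluations so far. -/
def Counted.loopStep {S R : Type} (body : S → Counted (R ⊕ S)) :
    S × ℕ →. (R × ℕ) ⊕ (S × ℕ) := fun a =>
  (body a.1).run.map fun r => match r with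
    | (Sum.inl b, m) => Sum.inl (b, a.2 + m)
    | (Sum.inr s', m) => Sum.inr (s', a.2 + m)

/-- Unbounded loop: run `body` until it returns `Sum.inl r`, and return `r`; a value `Sum.inr s` is
the state for the next pass. The gradient evaluations of all passes are added up. -/
def Counted.loop {S R : Type} (body : S → Counted (R ⊕ S)) (s : S) : Counted R :=
  ⟨(Counted.loopStep body).fix (s, 0)⟩

variable {E : Type} [NormedAddCommGroup E] [InnerProductSpace ℝ E] [CompleteSpace E]

/-- One gradient evaluation. -/
def gradEval (f : E → ℝ) (x : E) : Counted E := ⟨Part.some (∇ f x, 1)⟩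

/-! ### Monitored accelerated gradient descent -/

/-- The history after `t` steps of accelerated gradient descent: the points `x s` and `y s` for
`s ≤ t`, and the gradients `gx s` evaluated at `x s` for `s < t`. Other entries are irrelevant. -/
structure History (E : Type) where
  t : ℕ
  x : ℕ → E
  y : ℕ → E
  gx : ℕ → E

open Classical in
/-- The progress test at the point `yt = y_t`, where `gyt` is the gradient of `f` at `yt`.
`none` stands for NULL. -/
def certifyProgress (f : E → ℝ) (y₀ yt gyt : E) (L σ κ : ℝ) (t : ℕ) : Option E :=
  if f yt > f y₀ then some y₀
  else
    let z := yt - (1 / L) • gyt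
    let ψ := f y₀ - f z + σ / 2 * ‖z - y₀‖ ^ 2
    if ‖gyt‖ ^ 2 > 2 * L * ψ * Real.exp (-(t : ℝ) / √κ) then some z else none

open Classical in
/-- The first pair `(u, x j)`, for `j = 0, …, t - 1` and `u = y j, w` in this order, that violates
`σ`-strong convexity. It uses the stored gradients at `x j`. -/
def findWitnessPair (f : E → ℝ) (h : History E) (w : E) (σ : ℝ) : Option (E × E) :=
  (((List.range h.t).flatMap fun j => [(h.y j, j), (w, j)]).find? fun c =>
      decide (f c.1 < f (h.x c.2) + inner ℝ (h.gx c.2) (c.1 - h.x c.2)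
        + σ / 2 * ‖c.1 - h.x c.2‖ ^ 2)).map
    fun c => (c.1, h.x c.2)

/-- The accelerated gradient step: from the history up to time `t - 1` and the gradient `g` at
`x (t - 1)` to the history up to time `t`. -/
def agdStep (L σ : ℝ) (h : History E) (g : E) : History E :=
  let κ := L / σ
  let ω := (√κ - 1) / (√κ + 1)
  let yt := h.x h.t - (1 / L) • g
  let xt := yt + ω • (yt - h.y h.t)
  { t := h.t + 1
    x := Function.update h.x (h.t + 1) xt
    y := Function.update h.y (h.t + 1) yt
    gx := Function.update h.gx h.t g }

open Classical in
/-- One pass of the loop of monitored accelerated gradient descent. Gradients are evaluated once at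
`x (t - 1)` and once at `y t`, and are stored or handed on where they are needed again. -/
def agdBody (f : E → ℝ) (y₀ : E) (ε L σ : ℝ) (h : History E) :
    Counted ((History E × Option (E × E)) ⊕ History E) := do
  let g ← gradEval f (h.x h.t)
  let h' := agdStep L σ h g
  let gy ← gradEval f (h'.y h'.t)
  match certifyProgress f y₀ (h'.y h'.t) gy L σ (L / σ) h'.t with
  | some w => do
      let uv ← Counted.ofOption (findWitnessPair f h' w σ)
      return Sum.inl (h', some uv)
  | none =>
      if ‖gy‖ ≤ ε then return Sum.inl (h', none) else return Sum.inr h'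

/-- Accelerated gradient descent on `f` from `y₀`, until the gradient norm is at most `ε` (second
component `none`) or until a pair `(u, v)` proves that `f` is not `σ`-strongly convex. -/
def agdUntilProvenGuilty (f : E → ℝ) (y₀ : E) (ε L σ : ℝ) :
    Counted (History E × Option (E × E)) :=
  Counted.loop (agdBody f y₀ ε L σ) ⟨0, fun _ => y₀, fun _ => y₀, fun _ => 0⟩

/-! ### The third-order subroutines and the outer method -/

/-- A rule for the choices that the method leaves open: which minimizer `argmin` returns over a
finite list of points, and which index `j < t` with `v = x j` is taken if there are several. -/
structure Choices (E : Type) where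
  argmin : (E → ℝ) → List E → E
  argmin_mem : ∀ (f : E → ℝ) (l : List E), l ≠ [] → argmin f l ∈ l
  argmin_le : ∀ (f : E → ℝ) (l : List E), ∀ z ∈ l, f (argmin f l) ≤ f z
  index : (ℕ → E) → ℕ → E → ℕ
  index_spec : ∀ (x : ℕ → E) (t : ℕ) (v : E), (∃ j < t, x j = v) → index x t v < t ∧ x (index x t v) = v

/-- Such rules exist. -/
theorem Choices.nonempty (E : Type) [Inhabited E] : Nonempty (Choices E) := by
  classical
  have h : ∀ (f : E → ℝ) (l : List E), ∃ a, (l ≠ [] → a ∈ l) ∧ ∀ z ∈ l, f a ≤ f z := by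
    intro f l
    by_cases hl : l = []
    · exact ⟨default, by simp [hl]⟩
    · obtain ⟨a, ha, h⟩ := l.toFinset.exists_min_image f (by simpa using hl)
      exact ⟨a, fun _ => by simpa using ha, fun z hz => h z (by simpa using hz)⟩
  choose g hg using h
  have h' : ∀ (x : ℕ → E) (t : ℕ) (v : E), ∃ i, (∃ j < t, x j = v) → i < t ∧ x i = v := by
    intro x t v
    by_cases hv : ∃ j < t, x j = v
    · exact ⟨hv.choose, fun _ => hv.choose_spec⟩
    · exact ⟨0, fun hj => absurd hj hv⟩
  choose i hi using h'
  exact ⟨⟨g, fun f l => (hg f l).1, fun f l => (hg f l).2, i, hi⟩⟩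

/-- The better of two points on the line through `u` and `v`, beyond `v` and beyond `u`. -/
def exploitNCPair₃ (c : Choices E) (f : E → ℝ) (u v : E) (η : ℝ) : E :=
  let δ := (1 / ‖u - v‖) • (u - v)
  let η' := √(η * (η + ‖u - v‖)) - ‖u - v‖
  c.argmin f [v - η • δ, u + η' • δ]

/-- The best of `y 0, …, y t`, of `u`, and of two further points on the line through `y (j - 1)`
and `y j`, where `v = x j`. -/
def findBestIterate₃ (c : Choices E) (f : E → ℝ) (h : History E) (u v : E) : E :=
  let j := c.index h.x h.t v
  let cj := if 0 < j then (1 / 2 : ℝ) • (h.y j + h.y (j - 1)) else h.y 0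
  let qj := if 0 < j then (-2 : ℝ) • h.y j + (3 : ℝ) • h.y (j - 1) else h.y 0
  c.argmin f ((List.range (h.t + 1)).map h.y ++ [cj, qj, u])

/-- The new outer iterate, from the output of monitored accelerated gradient descent. -/
def nextIterate (c : Choices E) (f : E → ℝ) (η : ℝ) : History E × Option (E × E) → E
  | (h, none) => h.y h.t
  | (h, some (u, v)) =>
      let b₁ := findBestIterate₃ c f h u v
      let b₂ := exploitNCPair₃ c f u v η
      c.argmin f [b₁, b₂]

/-- The proximal function `x ↦ f x + α ‖x - p‖²`. One evaluation of its gradient is one evaluation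
of the gradient of `f`, as `∇ (prox f α p) x = ∇ f x + 2 α (x - p)`. -/
def prox (f : E → ℝ) (α : ℝ) (p : E) : E → ℝ := fun x => f x + α * ‖x - p‖ ^ 2

open Classical in
/-- One iteration of the outer method, from `p = p_{k-1}` to `p_k`. The gradient at `p_k` for the
stopping test is counted as one more evaluation. -/
def outerBody (c : Choices E) (f : E → ℝ) (L₁ ε α η : ℝ) (p : E) : Counted (E ⊕ E) := do
  let r ← agdUntilProvenGuilty (prox f α p) p (ε / 10) (L₁ + 2 * α) α
  let pk := nextIterate c f η r
  let g ← gradEval f pk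
  if ‖g‖ ≤ ε then return Sum.inl pk else return Sum.inr pk

/-- The whole method, with the third-order subroutines, started from `p₀`. -/
def guardedNonConvexAGD₃ (c : Choices E) (f : E → ℝ) (p₀ : E) (L₁ ε α η : ℝ) : Counted E :=
  Counted.loop (outerBody c f L₁ ε α η) p₀

end GuiltyAGD

end

/-!
The method minimizes at each outer iteration the proximal function `x ↦ f x + α ‖x - p‖²`, treating
it as an `α`-strongly convex function with condition number `κ = (L₁ + 2α) / α`.

*Cost of an outer iteration.* The classical Lyapunov argument for accelerated gradient descent uses
strong convexity only between the points `x s` and the two points `y s`, `w`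
(`IsTrajectory.convergence`). Hence a failed progress test always comes with a violating pair
(`exists_witnessPair`), so that the computation never aborts. While the test is passed, the gradient
at `y t` decays like `exp (-t / (2 √κ))`, so the run ends after `1 + √κ log (⋯)` steps
(`agdUntilProvenGuilty_outputs`).

*Progress of an outer iteration.* If the proximal problem is solved and `∇ f` is still large, then
the iterate has moved and the proximal term pays for it (`progress_of_large_gradient`). If a pair
`(u, v)` violates strong convexity of the proximal function, then `f` itself has curvature below
`-α` somewhere along the line through `u` and `v`, and a step of order `η` along this line
decreases `f` by a fixed fraction of `α η²`, relative to `u` or to `v`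
(`exploit_negative_curvature`). The value at `v` may exceed the one at `p`; but `v = x j` is an extrapolation of `y (j - 1)` and `y j`, and by cubic
interpolation along that line either one of the candidates `y s`, `c j`, `q j`, `u` already is much
better than `p`, or `f v` is only slightly larger than `f p` (`witness_bounds`). Both effects use
that `f` is a cubic along lines up to an error of fourth order, which follows from the Lipschitz
third derivative (`HasLipschitzNthDeriv.exists_cubic`).

*Count.* Every outer iteration but the last decreases `f` by at least `ε^(4/3) / (10 L₃^(1/3))`,
which bounds their number; `complexity_bound` combines this with the cost of one iteration.
-/

namespace GuiltyAGD

open scoped Gradient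

variable {E : Type} [NormedAddCommGroup E] [InnerProductSpace ℝ E] [CompleteSpace E]

/-! ### Taylor expansion with a Lipschitz top derivative -/

theorem abs_le_of_abs_deriv_le_pow {H H' : ℝ → ℝ} {M : ℝ} {n : ℕ} (h0 : H 0 = 0)
    (hH : ∀ θ, HasDerivAt H (H' θ) θ) (hb : ∀ θ, |H' θ| ≤ M * |θ| ^ n) (θ : ℝ) :
    |H θ| ≤ M * |θ| ^ (n + 1) / (n + 1) := by
  have hn : (n : ℝ) + 1 ≠ 0 := by positivity
  have hB : ∀ x : ℝ, HasDerivAt (fun x : ℝ => M * x ^ (n + 1) / (n + 1)) (M * x ^ n) x := by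
    intro x
    have h := ((hasDerivAt_pow (n + 1) x).const_mul M).div_const ((n : ℝ) + 1)
    refine h.congr_deriv ?_
    push_cast
    field_simp
  rcases le_total 0 θ with hθ | hθ
  · have := image_norm_le_of_norm_deriv_right_le_deriv_boundary (a := 0) (b := θ)
      (fun x _ => (hH x).continuousAt.continuousWithinAt) (fun x _ => (hH x).hasDerivWithinAt)
      (by simp [h0]) hB
      (fun x hx => by simpa [abs_of_nonneg hx.1] using hb x) (Set.right_mem_Icc.2 hθ)
    simpa [abs_of_nonneg hθ] using this
  · have hneg : ∀ x, HasDerivAt (fun x => H (-x)) (-H' (-x)) x := fun x => by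
      simpa [Function.comp_def] using (hH (-x)).comp x (hasDerivAt_neg x)
    have := image_norm_le_of_norm_deriv_right_le_deriv_boundary (a := 0) (b := -θ)
      (fun x _ => (hneg x).continuousAt.continuousWithinAt) (fun x _ => (hneg x).hasDerivWithinAt)
      (by simp [h0]) hB
      (fun x hx => by simpa [abs_of_nonneg hx.1] using hb (-x))
      (Set.right_mem_Icc.2 (by linarith))
    simpa [abs_of_nonpos hθ] using this

/-- Taylor's theorem at `0` for a function of one variable whose `n`-th derivative is Lipschitz at
`0`; the derivative of order `n + 1` need not exist. -/
theorem abs_sub_taylor_le {K : ℝ} (n : ℕ) (H : ℝ → ℝ)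
    (hd : ∀ m < n, Differentiable ℝ (iteratedDeriv m H))
    (hK : ∀ θ, |iteratedDeriv n H θ - iteratedDeriv n H 0| ≤ K * |θ|) (θ : ℝ) :
    |H θ - ∑ k ∈ Finset.range (n + 1), θ ^ k / (k.factorial : ℝ) * iteratedDeriv k H 0| ≤
      K * |θ| ^ (n + 1) / ((n + 1).factorial : ℝ) := by
  induction n generalizing H θ with
  | zero => simpa using hK θ
  | succ n ih =>
    have hdiff : Differentiable ℝ H := by simpa using hd 0 n.succ_pos
    have ih' := ih (deriv H)
      (fun m hm => by rw [← iteratedDeriv_succ']; exact hd (m + 1) (by omega))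
      (by rw [← iteratedDeriv_succ']; exact hK)
    have hpoly : ∀ x : ℝ, HasDerivAt
        (fun x : ℝ => ∑ k ∈ Finset.range (n + 2), x ^ k / (k.factorial : ℝ) * iteratedDeriv k H 0)
        (∑ k ∈ Finset.range (n + 1), x ^ k / (k.factorial : ℝ) *
          iteratedDeriv k (deriv H) 0) x := by
      intro x
      simp_rw [Finset.sum_range_succ' _ (n + 1), pow_zero]
      refine HasDerivAt.add_const _ (HasDerivAt.fun_sum fun k _ => ?_)
      have h := ((hasDerivAt_pow (k + 1) x).div_const ((k + 1).factorial : ℝ)).mul_const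
        (iteratedDeriv (k + 1) H 0)
      refine h.congr_deriv ?_
      rw [iteratedDeriv_succ', Nat.factorial_succ]
      have : (k.factorial : ℝ) ≠ 0 := by positivity
      push_cast
      field_simp
    have key := abs_le_of_abs_deriv_le_pow (n := n + 1)
      (H := fun x => H x - ∑ k ∈ Finset.range (n + 2),
        x ^ k / (k.factorial : ℝ) * iteratedDeriv k H 0)
      (M := K / ((n + 1).factorial : ℝ))
      (by simp [Finset.sum_range_succ' _ (n + 1)])
      (fun x => (hdiff x).hasDerivAt.sub (hpoly x))
      (fun x => by simpa only [div_mul_eq_mul_div] using ih' x) θ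
    refine key.trans_eq ?_
    rw [Nat.factorial_succ (n + 1)]
    have : ((n + 1).factorial : ℝ) ≠ 0 := by positivity
    push_cast
    field_simp

section

variable {F : Type} [NormedAddCommGroup F] [NormedSpace ℝ F] {f : F → ℝ}

theorem hasDerivAt_iteratedFDeriv_line {m : ℕ}
    (hd : Differentiable ℝ (iteratedFDeriv ℝ m f)) (x δ : F) (θ : ℝ) :
    HasDerivAt (fun θ : ℝ => iteratedFDeriv ℝ m f (x + θ • δ) fun _ => δ)
      (iteratedFDeriv ℝ (m + 1) f (x + θ • δ) fun _ => δ) θ := by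
  have hline : HasDerivAt (fun θ : ℝ => x + θ • δ) δ θ := by
    simpa using ((hasDerivAt_id θ).smul_const δ).const_add x
  have h := (hd (x + θ • δ)).hasFDerivAt.comp_hasDerivAt θ hline
  have h' := (ContinuousMultilinearMap.apply ℝ (fun _ : Fin m => F) ℝ
    (fun _ => δ)).hasFDerivAt.comp_hasDerivAt θ h
  rw [iteratedFDeriv_succ_apply_left]
  exact h'

theorem iteratedDeriv_line {n : ℕ}
    (hd : ∀ m < n, Differentiable ℝ (iteratedFDeriv ℝ m f)) (x δ : F) {m : ℕ} (hm : m ≤ n) :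
    iteratedDeriv m (fun θ : ℝ => f (x + θ • δ)) =
      fun θ : ℝ => iteratedFDeriv ℝ m f (x + θ • δ) fun _ => δ := by
  induction m with
  | zero => ext θ; simp
  | succ m ih =>
    rw [iteratedDeriv_succ, ih (by omega)]
    ext θ
    exact (hasDerivAt_iteratedFDeriv_line (hd m (by omega)) x δ θ).deriv

theorem HasLipschitzNthDeriv.abs_sub_taylor_le {n : ℕ} {L : ℝ}
    (hf : HasLipschitzNthDeriv n L f) (x s : F) :
    |f (x + s) - ∑ k ∈ Finset.range (n + 1),
        1 / (k.factorial : ℝ) * iteratedFDeriv ℝ k f x fun _ => s| ≤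
      L * ‖s‖ ^ (n + 1) / ((n + 1).factorial : ℝ) := by
  rcases eq_or_ne s 0 with rfl | hs
  · have h0 : ∀ k, (iteratedFDeriv ℝ (k + 1) f x fun _ => (0 : F)) = 0 :=
      fun k => (iteratedFDeriv ℝ (k + 1) f x).map_zero
    simp [Finset.sum_range_succ', h0]
  · have hs' : ‖s‖ ≠ 0 := norm_ne_zero_iff.2 hs
    set δ : F := ‖s‖⁻¹ • s with hδ
    have hδ1 : ‖δ‖ = 1 := by rw [hδ, norm_smul, norm_inv, norm_norm, inv_mul_cancel₀ hs']
    have hsδ : s = ‖s‖ • δ := by rw [hδ, smul_smul, mul_inv_cancel₀ hs', one_smul]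
    have h := GuiltyAGD.abs_sub_taylor_le (K := L) n (fun θ : ℝ => f (x + θ • δ))
      (fun m hm => by
        rw [iteratedDeriv_line hf.1 x δ hm.le]
        exact fun θ => (hasDerivAt_iteratedFDeriv_line (hf.1 m hm) x δ θ).differentiableAt)
      (fun θ => by simpa using hf.2 x δ hδ1 θ 0) ‖s‖
    rw [← hsδ, abs_norm] at h
    convert h using 3
    refine Finset.sum_congr rfl fun k hk => ?_
    rw [iteratedDeriv_line hf.1 x δ (by simpa [Nat.lt_succ_iff] using hk)]
    have : (iteratedFDeriv ℝ k f x fun _ => s) =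
        ‖s‖ ^ k * iteratedFDeriv ℝ k f x fun _ => δ := by
      conv_lhs => rw [hsδ]
      rw [ContinuousMultilinearMap.map_smul_univ]
      simp
    rw [this]
    simp only [zero_smul, add_zero]
    ring

theorem HasLipschitzNthDeriv.differentiable {n : ℕ} {L : ℝ} (hn : 0 < n)
    (hf : HasLipschitzNthDeriv n L f) : Differentiable ℝ f := by
  have h := hf.1 0 hn
  rw [iteratedFDeriv_zero_eq_comp] at h
  exact (LinearIsometryEquiv.comp_differentiable_iff _).1 h

/-- Along every line, a function with `L`-Lipschitz third derivatives is a cubic polynomial up to an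
error of fourth order. -/
theorem HasLipschitzNthDeriv.exists_cubic {L : ℝ} (hf : HasLipschitzNthDeriv 3 L f) (x s : F) :
    ∃ b c : ℝ, ∀ θ : ℝ,
      |f (x + θ • s) - (f x + fderiv ℝ f x s * θ + b * θ ^ 2 + c * θ ^ 3)| ≤
        L * ‖s‖ ^ 4 / 24 * θ ^ 4 := by
  refine ⟨1 / 2 * iteratedFDeriv ℝ 2 f x fun _ => s, 1 / 6 * iteratedFDeriv ℝ 3 f x fun _ => s,
    fun θ => ?_⟩
  have h := hf.abs_sub_taylor_le x (θ • s)
  have hk : ∀ k, (iteratedFDeriv ℝ k f x fun _ => θ • s) =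
      θ ^ k * iteratedFDeriv ℝ k f x fun _ => s := fun k => by
    rw [ContinuousMultilinearMap.map_smul_univ]
    simp
  simp only [hk, Finset.sum_range_succ, Finset.sum_range_zero, iteratedFDeriv_one_apply,
    iteratedFDeriv_zero_apply] at h
  have e : L * ‖θ • s‖ ^ 4 / 24 = L * ‖s‖ ^ 4 / 24 * θ ^ 4 := by
    rw [norm_smul, mul_pow, Real.norm_eq_abs, (by decide : Even 4).pow_abs]
    ring
  norm_num [Nat.factorial] at h
  rw [← e]
  refine le_trans (le_of_eq ?_) h
  congr 1
  ring

end

/-! ### Gradient steps on the proximal function -/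

theorem le_add_gradient_of_smooth {f : E → ℝ} {L : ℝ} (hf : HasLipschitzNthDeriv 1 L f) (x s : E) :
    f (x + s) ≤ f x + inner ℝ (∇ f x) s + L / 2 * ‖s‖ ^ 2 := by
  have h := (abs_le.1 (hf.abs_sub_taylor_le x s)).2
  rw [inner_gradient_left]
  simp only [Finset.sum_range_succ, Finset.sum_range_zero, iteratedFDeriv_one_apply,
    iteratedFDeriv_zero_apply] at h
  norm_num [Nat.factorial] at h
  linarith

theorem gradient_prox {f : E → ℝ} (hf : Differentiable ℝ f) (α : ℝ) (p x : E) :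
    ∇ (prox f α p) x = ∇ f x + (2 * α) • (x - p) := by
  refine HasGradientAt.gradient ?_
  rw [hasGradientAt_iff_hasFDerivAt]
  have h1 := (hf x).hasGradientAt.hasFDerivAt
  have h2 := ((((hasFDerivAt_id x).sub_const p).norm_sq).const_mul α)
  refine (h1.add h2).congr_fderiv ?_
  ext s
  simp
  ring

theorem prox_le_add_gradient {f : E → ℝ} {L : ℝ} (hf : HasLipschitzNthDeriv 1 L f) (α : ℝ)
    (p x s : E) : prox f α p (x + s) ≤
      prox f α p x + inner ℝ (∇ (prox f α p) x) s + (L + 2 * α) / 2 * ‖s‖ ^ 2 := by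
  have h := le_add_gradient_of_smooth hf x s
  rw [gradient_prox (hf.differentiable one_pos)]
  have e : ‖x + s - p‖ ^ 2 = ‖x - p‖ ^ 2 + 2 * inner ℝ (x - p) s + ‖s‖ ^ 2 := by
    rw [add_sub_right_comm, norm_add_sq_real]
  simp only [prox, e, inner_add_left, inner_smul_left]
  simp only [RCLike.conj_to_real]
  linarith

/-- The decrease of the proximal function under a gradient step of length `1 / (L + 2 * α)`. -/
theorem prox_gradient_step {f : E → ℝ} {L : ℝ} (hf : HasLipschitzNthDeriv 1 L f) {α : ℝ}
    (hL : 0 < L + 2 * α) (p x : E) :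
    prox f α p (x - (1 / (L + 2 * α)) • ∇ (prox f α p) x) ≤
      prox f α p x - 1 / (2 * (L + 2 * α)) * ‖∇ (prox f α p) x‖ ^ 2 := by
  have h := prox_le_add_gradient hf α p x (-((1 / (L + 2 * α)) • ∇ (prox f α p) x))
  rw [← sub_eq_add_neg] at h
  refine h.trans_eq ?_
  rw [inner_neg_right, real_inner_smul_right, real_inner_self_eq_norm_sq, norm_neg, norm_smul,
    mul_pow, Real.norm_eq_abs, sq_abs]
  field_simp
  ring

/-! ### Two consequences of Lipschitz third derivatives -/

/-- Extrapolation by the cubic interpolation polynomial at the nodes `-2, 0, 1/2, 1`. To the right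
of all nodes the Lagrange coefficients alternate in sign, so that upper bounds at `0` and `1` and
lower bounds at `-2` and `1/2` suffice for an upper bound. The Taylor expansion is about `1/2`,
which balances the errors at the nodes. -/
theorem HasLipschitzNthDeriv.extrapolation_le {F : Type} [NormedAddCommGroup F] [NormedSpace ℝ F]
    {f : F → ℝ} {L : ℝ} (hL : 0 ≤ L) (hf : HasLipschitzNthDeriv 3 L f) (y s : F) {a b ω : ℝ}
    (hb : 0 ≤ b) (hω0 : 0 ≤ ω) (hω1 : ω ≤ 1)
    (h0 : f y ≤ a) (h1 : f (y + s) ≤ a) (hc : a - b ≤ f (y + (1 / 2 : ℝ) • s))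
    (hq : a - b ≤ f (y + (-2 : ℝ) • s)) :
    f (y + (1 + ω) • s) ≤ a + 13 * b + 7 / 12 * L * ‖s‖ ^ 4 := by
  obtain ⟨β, γ, h⟩ := hf.exists_cubic (y + (1 / 2 : ℝ) • s) s
  have e : ∀ θ : ℝ, y + (1 / 2 : ℝ) • s + θ • s = y + (1 / 2 + θ) • s := fun θ => by module
  have e0 : y + (1 / 2 + -(1 / 2 : ℝ)) • s = y := by module
  have e1 : y + (1 / 2 + (1 / 2 : ℝ)) • s = y + s := by module
  have e2 : y + (1 / 2 + (1 / 2 + ω)) • s = y + (1 + ω) • s := by module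
  have e3 : y + (1 / 2 + -(5 / 2 : ℝ)) • s = y + (-2 : ℝ) • s := by module
  simp only [e] at h
  have h0' := (abs_le.1 (h (-(1 / 2)))).1
  have h1' := (abs_le.1 (h (1 / 2))).1
  have h2' := (abs_le.1 (h (1 / 2 + ω))).2
  have hq' := (abs_le.1 (h (-(5 / 2)))).2
  rw [e0] at h0'
  rw [e1] at h1'
  rw [e2] at h2'
  rw [e3] at hq'
  have hM : 0 ≤ L * ‖s‖ ^ 4 / 24 := by positivity
  have hM' : 7 / 12 * L * ‖s‖ ^ 4 = 14 * (L * ‖s‖ ^ 4 / 24) := by ring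
  rw [hM']
  generalize L * ‖s‖ ^ 4 / 24 = M at *
  generalize f (y + (1 / 2 : ℝ) • s) = fc at *
  generalize f (y + (1 + ω) • s) = fx at *
  generalize f (y + (-2 : ℝ) • s) = fq at *
  generalize f (y + s) = f1 at *
  generalize f y = f0 at *
  generalize fderiv ℝ f (y + (1 / 2 : ℝ) • s) s = A at *
  -- the moduli of the Lagrange coefficients at `1 + ω`
  have l1 : 0 ≤ 2 / 3 * (3 + ω) * (1 + ω) * (1 / 2 + ω) := by positivity
  have l0 : 0 ≤ (3 + ω) * (1 / 2 + ω) * ω := by positivity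
  have lc : 0 ≤ 8 / 5 * (3 + ω) * (1 + ω) * ω := by positivity
  have lq : 0 ≤ 1 / 15 * (1 + ω) * (1 / 2 + ω) * ω := by positivity
  have m1 := mul_le_mul_of_nonneg_left
    (show fc + A * (1 / 2) + β * (1 / 2) ^ 2 + γ * (1 / 2) ^ 3 ≤ a + M / 16 by linarith) l1
  have m0 := mul_le_mul_of_nonneg_left
    (show fc + A * -(1 / 2) + β * (-(1 / 2)) ^ 2 + γ * (-(1 / 2)) ^ 3 ≤ a + M / 16 by linarith) l0
  have mc := mul_le_mul_of_nonneg_left hc lc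
  have mq := mul_le_mul_of_nonneg_left
    (show a - b - M * (5 / 2) ^ 4 ≤
      fc + A * -(5 / 2) + β * (-(5 / 2)) ^ 2 + γ * (-(5 / 2)) ^ 3 by linarith) lq
  have p2 : ω ^ 2 ≤ 1 := pow_le_one₀ hω0 hω1
  have p3 : ω ^ 3 ≤ 1 := pow_le_one₀ hω0 hω1
  have p4 : ω ^ 4 ≤ 1 := pow_le_one₀ hω0 hω1
  have nb : (8 / 5 * (3 + ω) * (1 + ω) * ω + 1 / 15 * (1 + ω) * (1 / 2 + ω) * ω) * b ≤ 13 * b :=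
    mul_le_mul_of_nonneg_right (by nlinarith only [hω0, hω1, p2, p3]) hb
  have nM : ((1 / 2 + ω) ^ 4 + (2 / 3 * (3 + ω) * (1 + ω) * (1 / 2 + ω)
      + (3 + ω) * (1 / 2 + ω) * ω) / 16
      + 1 / 15 * (1 + ω) * (1 / 2 + ω) * ω * (5 / 2) ^ 4) * M ≤ 14 * M :=
    mul_le_mul_of_nonneg_right (by nlinarith only [hω0, hω1, p2, p3, p4]) hM
  linarith

/-- The one-variable core of `exploit_negative_curvature`, in units in which `η = 1` and
`L = 2 * α`: `F`, `g₁`, `gR`, `gρ` are the values at `0, -1, R, ρ` of a function with Taylor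
coefficients `F, A, β, γ` at `0`. The choice of `ρ` makes the upper bound for `gρ - gR` a multiple
of `β + γ * R`, which is the combination that the witness of concavity controls. -/
theorem exploit_negative_curvature_aux {W R ρ A β γ F g₁ gR gρ : ℝ} (hW : 0 < W) (hR : 0 < R)
    (hR2 : R ≤ 1 / 2) (hρ : 0 ≤ ρ) (hρR : ρ ^ 2 = 1 + R)
    (h₁ : g₁ ≤ F - A + β - γ + W / 12)
    (hgρ : gρ ≤ F + A * ρ + β * ρ ^ 2 + γ * ρ ^ 3 + W / 12 * ρ ^ 4)
    (hgR : F + A * R + β * R ^ 2 + γ * R ^ 3 - W / 12 * R ^ 4 ≤ gR)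
    (hnc : gR < F + A * R - W / 2 * R ^ 2) :
    g₁ ≤ F - W / 4 ∨ gρ ≤ gR - W / 12 := by
  by_contra! hcon
  obtain ⟨c1, c2⟩ := hcon
  have hρ1 : 1 ≤ ρ := by nlinarith
  have hA : A ≤ β - γ + W / 3 := by linarith
  have hcurv : β + γ * R ≤ W * (R ^ 2 / 12 - 1 / 2) := by
    by_contra! h
    have := mul_lt_mul_of_pos_right h (pow_pos hR 2)
    linarith
  have hρR' : 0 ≤ ρ - R := by linarith
  have hA' := mul_le_mul_of_nonneg_left hA hρR'
  have hk : 0 ≤ ρ + 1 - R ^ 2 := by nlinarith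
  have hcurv' := mul_le_mul_of_nonneg_left hcurv hk
  have e3 : ρ ^ 3 = ρ * (1 + R) := by rw [← hρR]; ring
  have e4 : ρ ^ 4 = (1 + R) ^ 2 := by rw [← hρR]; ring
  have hR4 : R ^ 4 ≤ 1 / 16 := by
    have := pow_le_pow_left₀ hR.le hR2 4
    linarith
  have hR2' : R ^ 2 ≤ 1 / 4 := by nlinarith
  have hfin : (ρ + 1 - R ^ 2) * (R ^ 2 / 12 - 1 / 2) + (ρ - R) / 3
      + ((1 + R) ^ 2 + R ^ 4) / 12 ≤ -(1 / 12) := by nlinarith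
  have hfin' := mul_le_mul_of_nonneg_left hfin hW.le
  rw [e3, e4, hρR] at hgρ
  have id1 : (ρ - R) * (β - γ + W / 3) + β * (1 + R - R ^ 2) + γ * (ρ * (1 + R) - R ^ 3) =
      (ρ + 1 - R ^ 2) * (β + γ * R) + W * ((ρ - R) / 3) := by
    ring
  linarith

/-- If `f u` lies below the linear approximation at `v` by more than `α / 2 * ‖u - v‖ ^ 2`, and `u`
and `v` are close, then on the line through them either the point at distance `η` behind `v` is much
better than `v`, or a point suitably far beyond `u` is much better than `u`. -/
theorem exploit_negative_curvature {f : E → ℝ} {L α η : ℝ} (hα : 0 < α) (hη : 0 < η)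
    (hL : L * η ^ 2 = 2 * α) (hf : HasLipschitzNthDeriv 3 L f) {u v : E}
    (hr : ‖u - v‖ ≤ η / 2)
    (huv : f u < f v + inner ℝ (∇ f v) (u - v) - α / 2 * ‖u - v‖ ^ 2) :
    f (v - η • (1 / ‖u - v‖) • (u - v)) ≤ f v - α / 4 * η ^ 2 ∨
      f (u + (√(η * (η + ‖u - v‖)) - ‖u - v‖) • (1 / ‖u - v‖) • (u - v)) ≤
        f u - α / 12 * η ^ 2 := by
  have hne : u ≠ v := by
    rintro rfl
    simp at huv
  have hr0 : 0 < ‖u - v‖ := norm_pos_iff.2 (sub_ne_zero.2 hne)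
  set r := ‖u - v‖ with hrdef
  set s : E := (η / r) • (u - v) with hs
  have hsn : ‖s‖ = η := by
    rw [hs, norm_smul, ← hrdef, Real.norm_eq_abs, abs_of_pos (by positivity)]
    field_simp
  have hus : u - v = (r / η) • s := by
    rw [hs, smul_smul, div_mul_div_comm, mul_comm η r, div_self (by positivity), one_smul]
  obtain ⟨β, γ, h⟩ := hf.exists_cubic v s
  have hM : L * ‖s‖ ^ 4 / 24 = α * η ^ 2 / 12 := by
    rw [hsn]
    linear_combination η ^ 2 / 24 * hL
  rw [hM] at h
  have hsq : √(η * (η + r)) = η * √(1 + r / η) := by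
    rw [show η * (η + r) = η ^ 2 * (1 + r / η) by field_simp, Real.sqrt_mul (by positivity),
      Real.sqrt_sq hη.le]
  have p1 : v - η • (1 / r) • (u - v) = v + (-1 : ℝ) • s := by
    rw [hs]
    module
  have p2 : u + (√(η * (η + r)) - r) • (1 / r) • (u - v) = v + √(1 + r / η) • s := by
    have : u = v + (r / r) • (u - v) := by rw [div_self hr0.ne']; module
    rw [hsq, hs]
    nth_rewrite 1 [this]
    module
  have p3 : u = v + (r / η) • s := by rw [← hus]; module
  have hA : inner ℝ (∇ f v) (u - v) = fderiv ℝ f v s * (r / η) := by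
    rw [hus, real_inner_smul_right, inner_gradient_left, mul_comm]
  have hgR := h (r / η)
  rw [← p3] at hgR
  rw [p1, p2, show α / 4 * η ^ 2 = α * η ^ 2 / 4 by ring,
    show α / 12 * η ^ 2 = α * η ^ 2 / 12 by ring]
  refine exploit_negative_curvature_aux (W := α * η ^ 2) (R := r / η) (ρ := √(1 + r / η))
    (A := fderiv ℝ f v s) (β := β) (γ := γ) (by positivity) (by positivity)
    (by rw [div_le_iff₀ hη]; linarith) (Real.sqrt_nonneg _) (Real.sq_sqrt (by positivity))
    ?_ ?_ ?_ ?_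
  · have := (abs_le.1 (h (-1))).2
    linarith
  · have := (abs_le.1 (h √(1 + r / η))).2
    linarith
  · have := (abs_le.1 hgR).1
    linarith
  · rw [hA] at huv
    refine huv.trans_eq ?_
    field_simp

/-! ### Counted computations -/

theorem outputs_pure {A : Type} (a : A) : (pure a : Counted A).Outputs a 0 :=
  Part.mem_some _

theorem outputs_gradEval (f : E → ℝ) (x : E) : (gradEval f x).Outputs (∇ f x) 1 :=
  Part.mem_some _

theorem outputs_ofOption {A : Type} (a : A) : (Counted.ofOption (some a)).Outputs a 0 := by
  simp [Counted.ofOption, Counted.Outputs]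

theorem Counted.Outputs.bind {A B : Type} {c : Counted A} {k : A → Counted B} {a : A} {b : B}
    {m n : ℕ} (hc : c.Outputs a m) (hk : (k a).Outputs b n) : (c >>= k).Outputs b (m + n) :=
  Part.mem_bind hc (Part.mem_map (fun r' : B × ℕ => (r'.1, m + r'.2)) hk)

/-- Total correctness rule for loops: `Inv s n` is an invariant that relates the loop state to the
number of gradient evaluations so far, and `rank` a variant that decreases in every pass. -/
theorem outputs_loop {S R : Type} {body : S → Counted (R ⊕ S)} (Inv : S → ℕ → Prop)
    (Post : R → ℕ → Prop) (rank : S → ℕ)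
    (hbody : ∀ s n, Inv s n → ∃ o m, (body s).Outputs o m ∧
      ((∃ r, o = Sum.inl r ∧ Post r (n + m)) ∨
        ∃ s', o = Sum.inr s' ∧ Inv s' (n + m) ∧ rank s' < rank s))
    {s : S} (hs : Inv s 0) : ∃ r N, (Counted.loop body s).Outputs r N ∧ Post r N := by
  have main : ∀ k s n, rank s = k → Inv s n →
      ∃ r N, (r, N) ∈ (Counted.loopStep body).fix (s, n) ∧ Post r N := by
    intro k
    induction k using Nat.strong_induction_on with
    | _ k ih =>
      intro s n hk hI
      obtain ⟨o, m, ho, ⟨r, rfl, hP⟩ | ⟨s', rfl, hI', hlt⟩⟩ := hbody s n hI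
      · refine ⟨r, n + m, PFun.mem_fix_iff.2 (Or.inl ?_), hP⟩
        exact (Part.mem_map_iff _).2 ⟨_, ho, rfl⟩
      · obtain ⟨r, N, hN, hP⟩ := ih (rank s') (hk ▸ hlt) s' (n + m) rfl hI'
        refine ⟨r, N, PFun.mem_fix_iff.2 (Or.inr ⟨(s', n + m), ?_, hN⟩), hP⟩
        exact (Part.mem_map_iff _).2 ⟨_, ho, rfl⟩
  exact main _ s 0 rfl hs

/-! ### Accelerated gradient descent under strong convexity at the iterates -/

/-- The Lyapunov inequality of accelerated gradient descent, for one step from `(x, y)` with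
gradient `G` at `x`. The numbers `fx, fy, fw, fy'` are function values at `x`, `y`, `w` and at the
new `y`; strong convexity is needed only between `x` and the two points `y`, `w`. -/
theorem lyapunov_step {F : Type} [NormedAddCommGroup F] [InnerProductSpace ℝ F] {x y w G : F}
    {fx fy fw fy' σ K : ℝ} (hσ : 0 < σ) (hK : 1 ≤ K)
    (hdesc : fy' ≤ fx - 1 / (2 * (σ * K ^ 2)) * ‖G‖ ^ 2)
    (hy : fx + inner ℝ G (y - x) + σ / 2 * ‖y - x‖ ^ 2 ≤ fy)
    (hw : fx + inner ℝ G (w - x) + σ / 2 * ‖w - x‖ ^ 2 ≤ fw) {x' y' : F}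
    (hy' : y' = x - (1 / (σ * K ^ 2)) • G) (hx' : x' = y' + ((K - 1) / (K + 1)) • (y' - y)) :
    fy' - fw + σ / 2 * ‖x' + K • (x' - y') - w‖ ^ 2 ≤
      (1 - 1 / K) * (fy - fw + σ / 2 * ‖x + K • (x - y) - w‖ ^ 2) := by
  have hK0 : 0 < K := by linarith
  set q : ℝ := 1 / K with hq
  have hq0 : 0 < q := by positivity
  have hq1 : q ≤ 1 := by rw [hq, div_le_one hK0]; exact hK
  set a : F := x + K • (x - y) - w with ha
  set b : F := x - w with hb
  have hqK : q * K = 1 := by rw [hq]; field_simp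
  have e1 : x' + K • (x' - y') - w = (1 - q) • a + q • b - (q / σ) • G := by
    have h1 : x' + K • (x' - y') = y' + (K - 1) • (y' - y) := by
      have h2 : (K + 1) * ((K - 1) / (K + 1)) = K - 1 := by field_simp
      generalize (K - 1) / (K + 1) = c at h2 hx'
      rw [hx', ← h2]
      module
    have hc : K * (1 / (σ * K ^ 2)) = q / σ := by rw [hq]; field_simp
    have h3 : (1 - q) • a + q • b = x + (K - 1) • (x - y) - w := by
      have : (1 - q) • a + q • b = x + (K - q * K) • (x - y) - w := by
        rw [ha, hb]; module
      rw [this, hqK]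
    rw [h1, h3, hy', ← hc]
    module
  have e2 : y - x = -(q • (a - b)) := by
    have : q • (a - b) = (q * K) • (x - y) := by rw [ha, hb]; module
    rw [this, hqK]; module
  have e3 : w - x = -b := by rw [hb]; module
  have n1 : ‖(1 - q) • a + q • b - (q / σ) • G‖ ^ 2 =
      (1 - q) * ‖a‖ ^ 2 + q * ‖b‖ ^ 2 - q * (1 - q) * ‖a - b‖ ^ 2
        - 2 * (q / σ) * ((1 - q) * inner ℝ G a + q * inner ℝ G b) + (q / σ) ^ 2 * ‖G‖ ^ 2 := by
    rw [norm_sub_sq_real, norm_add_sq_real, norm_sub_sq_real a b]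
    simp only [norm_smul, mul_pow, Real.norm_eq_abs, sq_abs, inner_add_left, real_inner_smul_left,
      real_inner_smul_right, real_inner_comm G]
    ring
  have hy2 : fx - q * (inner ℝ G a - inner ℝ G b) ≤ fy := by
    rw [e2, inner_neg_right, real_inner_smul_right, inner_sub_right] at hy
    have : 0 ≤ σ / 2 * ‖-(q • (a - b))‖ ^ 2 := by positivity
    linarith
  have hw2 : fx - inner ℝ G b + σ / 2 * ‖b‖ ^ 2 ≤ fw := by
    rw [e3, inner_neg_right, norm_neg] at hw
    linarith
  have hG : 1 / (2 * (σ * K ^ 2)) * ‖G‖ ^ 2 = σ / 2 * ((q / σ) ^ 2 * ‖G‖ ^ 2) := by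
    rw [hq]; field_simp
  have hab : 0 ≤ σ / 2 * (q * (1 - q) * ‖a - b‖ ^ 2) := by
    have : 0 ≤ 1 - q := by linarith
    positivity
  have hcross : σ / 2 * (2 * (q / σ) * ((1 - q) * inner ℝ G a + q * inner ℝ G b)) =
      q * ((1 - q) * inner ℝ G a + q * inner ℝ G b) := by field_simp
  have p1 := mul_le_mul_of_nonneg_left hy2 (show 0 ≤ 1 - q by linarith)
  have p2 := mul_le_mul_of_nonneg_left hw2 hq0.le
  rw [e1, n1]
  linarith

/-- The entries of the history `h` are the iterates of accelerated gradient descent on `g` from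
`y₀`, together with the gradients of `g` at the points `x s`. -/
structure IsTrajectory (g : E → ℝ) (y₀ : E) (L σ : ℝ) (h : History E) : Prop where
  x_zero : h.x 0 = y₀
  y_zero : h.y 0 = y₀
  gx_eq : ∀ s < h.t, h.gx s = ∇ g (h.x s)
  y_succ : ∀ s < h.t, h.y (s + 1) = h.x s - (1 / L) • ∇ g (h.x s)
  x_succ : ∀ s < h.t, h.x (s + 1) =
    h.y (s + 1) + ((√(L / σ) - 1) / (√(L / σ) + 1)) • (h.y (s + 1) - h.y s)

theorem IsTrajectory.agdStep {g : E → ℝ} {y₀ : E} {L σ : ℝ} {h : History E}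
    (hh : IsTrajectory g y₀ L σ h) :
    IsTrajectory g y₀ L σ (agdStep L σ h (∇ g (h.x h.t))) where
  x_zero := by simpa [GuiltyAGD.agdStep] using hh.x_zero
  y_zero := by simpa [GuiltyAGD.agdStep] using hh.y_zero
  gx_eq s hs := by
    change s < h.t + 1 at hs
    rcases Nat.lt_succ_iff_lt_or_eq.1 hs with hs' | rfl
    · simpa [GuiltyAGD.agdStep, hs'.ne, hs.ne] using hh.gx_eq s hs'
    · simp [GuiltyAGD.agdStep]
  y_succ s hs := by
    change s < h.t + 1 at hs
    rcases Nat.lt_succ_iff_lt_or_eq.1 hs with hs' | rfl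
    · simpa [GuiltyAGD.agdStep, hs'.ne, hs.ne] using hh.y_succ s hs'
    · simp [GuiltyAGD.agdStep]
  x_succ s hs := by
    change s < h.t + 1 at hs
    rcases Nat.lt_succ_iff_lt_or_eq.1 hs with hs' | rfl
    · simpa [GuiltyAGD.agdStep, hs'.ne, hs.ne] using hh.x_succ s hs'
    · simp [GuiltyAGD.agdStep]

/-- `g` satisfies at `x` the inequality of `σ`-strong convexity towards `u`. -/
def StronglyConvexAt (g : E → ℝ) (σ : ℝ) (x u : E) : Prop :=
  g x + inner ℝ (∇ g x) (u - x) + σ / 2 * ‖u - x‖ ^ 2 ≤ g u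

/-- The linear convergence of accelerated gradient descent towards the value at `w`, where `w` need
not be a minimizer. -/
theorem IsTrajectory.convergence {g : E → ℝ} {y₀ w : E} {L σ : ℝ} {h : History E}
    (hh : IsTrajectory g y₀ L σ h) (hσ : 0 < σ) (hσL : σ ≤ L)
    (hdesc : ∀ x, g (x - (1 / L) • ∇ g x) ≤ g x - 1 / (2 * L) * ‖∇ g x‖ ^ 2)
    (hconv : ∀ s < h.t, StronglyConvexAt g σ (h.x s) (h.y s) ∧ StronglyConvexAt g σ (h.x s) w) :
    g (h.y h.t) - g w ≤ (1 - 1 / √(L / σ)) ^ h.t * (g y₀ - g w + σ / 2 * ‖w - y₀‖ ^ 2) := by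
  set K := √(L / σ) with hK
  have hK1 : 1 ≤ K := by rw [hK, Real.one_le_sqrt, le_div_iff₀ hσ]; linarith
  have hKL : L = σ * K ^ 2 := by
    rw [hK, Real.sq_sqrt (div_nonneg (hσ.le.trans hσL) hσ.le)]; field_simp
  have hr : 0 ≤ 1 - 1 / K := by
    rw [sub_nonneg, div_le_one (by linarith)]; exact hK1
  have key : ∀ s ≤ h.t, g (h.y s) - g w + σ / 2 * ‖h.x s + K • (h.x s - h.y s) - w‖ ^ 2 ≤
      (1 - 1 / K) ^ s * (g y₀ - g w + σ / 2 * ‖w - y₀‖ ^ 2) := by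
    intro s
    induction s with
    | zero => intro _; simp [hh.x_zero, hh.y_zero, norm_sub_rev]
    | succ s ih =>
      intro hs
      have hs' : s < h.t := hs
      have step := lyapunov_step hσ hK1 (hKL ▸ hdesc (h.x s)) (hconv s hs').1 (hconv s hs').2
        (y' := h.y (s + 1)) (hKL ▸ hh.y_succ s hs') (hh.x_succ s hs')
      rw [← hKL, ← hh.y_succ s hs'] at step
      refine step.trans ?_
      rw [pow_succ' (1 - 1 / K), mul_assoc]
      exact mul_le_mul_of_nonneg_left (ih hs'.le) hr
  have := key h.t le_rfl
  have hnn : 0 ≤ σ / 2 * ‖h.x h.t + K • (h.x h.t - h.y h.t) - w‖ ^ 2 := by positivity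
  linarith

/-! ### The monitored method -/

theorem findWitnessPair_eq_none {g : E → ℝ} {y₀ w : E} {L σ : ℝ} {h : History E}
    (hh : IsTrajectory g y₀ L σ h) (hnone : findWitnessPair g h w σ = none) :
    ∀ s < h.t, StronglyConvexAt g σ (h.x s) (h.y s) ∧ StronglyConvexAt g σ (h.x s) w := by
  intro s hs
  simp only [findWitnessPair, Option.map_eq_none_iff, List.find?_eq_none, List.mem_flatMap,
    List.mem_range, decide_eq_true_eq, not_lt] at hnone
  have h1 := hnone (h.y s, s) ⟨s, hs, by simp⟩
  have h2 := hnone (w, s) ⟨s, hs, by simp⟩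
  rw [hh.gx_eq s hs] at h1 h2
  exact ⟨h1, h2⟩

theorem findWitnessPair_eq_some {g : E → ℝ} {y₀ w : E} {L σ : ℝ} {h : History E}
    (hh : IsTrajectory g y₀ L σ h) {u v : E} (hsome : findWitnessPair g h w σ = some (u, v)) :
    ¬StronglyConvexAt g σ v u ∧ ∃ j < h.t, h.x j = v ∧ (u = h.y j ∨ u = w) := by
  simp only [findWitnessPair, Option.map_eq_some_iff] at hsome
  obtain ⟨⟨u', j⟩, hfind, heq⟩ := hsome
  obtain ⟨rfl, rfl⟩ := Prod.mk.inj heq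
  have hmem := List.mem_of_find?_eq_some hfind
  have hviol := List.find?_some hfind
  simp only [List.mem_flatMap, List.mem_range, List.mem_cons, Prod.mk.injEq, List.not_mem_nil,
    or_false] at hmem
  obtain ⟨i, hi, ⟨rfl, rfl⟩ | ⟨rfl, rfl⟩⟩ := hmem
  all_goals
    simp only [decide_eq_true_eq] at hviol
    rw [hh.gx_eq _ hi] at hviol
    exact ⟨not_le.2 hviol, _, hi, rfl, by simp⟩

theorem certifyProgress_eq_none {F : Type} [NormedAddCommGroup F] [InnerProductSpace ℝ F]
    {g : F → ℝ} {y₀ y gy : F} {L σ κ : ℝ} {t : ℕ}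
    (hnone : certifyProgress g y₀ y gy L σ κ t = none) :
    g y ≤ g y₀ ∧ ‖gy‖ ^ 2 ≤ 2 * L * (g y₀ - g (y - (1 / L) • gy)
      + σ / 2 * ‖y - (1 / L) • gy - y₀‖ ^ 2) * Real.exp (-(t : ℝ) / √κ) := by
  unfold certifyProgress at hnone
  split_ifs at hnone with h1
  dsimp only at hnone
  split_ifs at hnone with h2
  exact ⟨not_lt.1 h1, not_lt.1 h2⟩

theorem certifyProgress_eq_some {F : Type} [NormedAddCommGroup F] [InnerProductSpace ℝ F]
    {g : F → ℝ} {y₀ y gy w : F} {L σ κ : ℝ} {t : ℕ}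
    (hsome : certifyProgress g y₀ y gy L σ κ t = some w) :
    (g y₀ < g y ∧ w = y₀) ∨ (g y ≤ g y₀ ∧ w = y - (1 / L) • gy ∧
      2 * L * (g y₀ - g w + σ / 2 * ‖w - y₀‖ ^ 2) * Real.exp (-(t : ℝ) / √κ) < ‖gy‖ ^ 2) := by
  unfold certifyProgress at hsome
  split_ifs at hsome with h1
  · exact Or.inl ⟨h1, (Option.some.inj hsome).symm⟩
  · dsimp only at hsome
    split_ifs at hsome with h2
    obtain rfl := Option.some.inj hsome
    exact Or.inr ⟨not_lt.1 h1, rfl, h2⟩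

/-- If the progress test fails, then some pair of points violates strong convexity: otherwise the
convergence bound towards `w` contradicts the failed test. -/
theorem exists_witnessPair {g : E → ℝ} {y₀ w : E} {L σ : ℝ} {h : History E}
    (hh : IsTrajectory g y₀ L σ h) (hσ : 0 < σ) (hσL : σ ≤ L)
    (hdesc : ∀ x, g (x - (1 / L) • ∇ g x) ≤ g x - 1 / (2 * L) * ‖∇ g x‖ ^ 2)
    (hcert : certifyProgress g y₀ (h.y h.t) (∇ g (h.y h.t)) L σ (L / σ) h.t = some w) :
    g w ≤ g y₀ ∧ ∃ u v, findWitnessPair g h w σ = some (u, v) := by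
  have hL : 0 < L := hσ.trans_le hσL
  have hw : g w ≤ g y₀ := by
    rcases certifyProgress_eq_some hcert with ⟨-, rfl⟩ | ⟨h1, rfl, -⟩
    · exact le_rfl
    · have := hdesc (h.y h.t)
      have hnn : 0 ≤ 1 / (2 * L) * ‖∇ g (h.y h.t)‖ ^ 2 := by positivity
      linarith
  refine ⟨hw, ?_⟩
  by_contra hno
  have hnone : findWitnessPair g h w σ = none := by
    rcases hf : findWitnessPair g h w σ with _ | ⟨u, v⟩
    · rfl
    · exact absurd ⟨u, v, hf⟩ hno
  have hc := hh.convergence hσ hσL hdesc (findWitnessPair_eq_none hh hnone)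
  rcases certifyProgress_eq_some hcert with ⟨h1, rfl⟩ | ⟨h1, hwz, h2⟩
  · simp at hc
    linarith
  · have hd := hdesc (h.y h.t)
    rw [← hwz] at hd
    set ψ := g y₀ - g w + σ / 2 * ‖w - y₀‖ ^ 2 with hψ
    have hψ0 : 0 ≤ ψ := by
      have : 0 ≤ σ / 2 * ‖w - y₀‖ ^ 2 := by positivity
      linarith
    have hK1 : 1 ≤ √(L / σ) := by rw [Real.one_le_sqrt, le_div_iff₀ hσ]; linarith
    have hpow : (1 - 1 / √(L / σ)) ^ h.t ≤ Real.exp (-(h.t : ℝ) / √(L / σ)) := by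
      have h3 : 0 ≤ 1 - 1 / √(L / σ) := by
        rw [sub_nonneg, div_le_one (by linarith)]; exact hK1
      refine (pow_le_pow_left₀ h3 (Real.one_sub_le_exp_neg _) h.t).trans_eq ?_
      rw [← Real.exp_nat_mul]
      congr 1
      ring
    have h4 := mul_le_mul_of_nonneg_right hpow hψ0
    have h5 : 1 / (2 * L) * (2 * L * ψ * Real.exp (-(h.t : ℝ) / √(L / σ))) <
        1 / (2 * L) * ‖∇ g (h.y h.t)‖ ^ 2 := mul_lt_mul_of_pos_left h2 (by positivity)
    have h6 : 1 / (2 * L) * (2 * L * ψ * Real.exp (-(h.t : ℝ) / √(L / σ))) =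
        Real.exp (-(h.t : ℝ) / √(L / σ)) * ψ := by field_simp
    linarith

/-- What is known about the result of the monitored method. The bound `Δ` on the potential `ψ` makes
the threshold of the progress test fall below `ε` in time, which bounds the number of steps. -/
theorem agdUntilProvenGuilty_outputs {g : E → ℝ} {y₀ : E} {ε L σ Δ : ℝ} (hε : 0 < ε) (hσ : 0 < σ)
    (hσL : σ ≤ L) (hdesc : ∀ x, g (x - (1 / L) • ∇ g x) ≤ g x - 1 / (2 * L) * ‖∇ g x‖ ^ 2)
    (hΔ : ∀ z, g y₀ - g z + σ / 2 * ‖z - y₀‖ ^ 2 ≤ Δ)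
    (hlog : 0 ≤ Real.log (2 * L * Δ / ε ^ 2)) :
    ∃ r : History E × Option (E × E),
      (agdUntilProvenGuilty g y₀ ε L σ).Outputs r (2 * r.1.t) ∧
      (r.1.t : ℝ) ≤ √(L / σ) * Real.log (2 * L * Δ / ε ^ 2) + 1 ∧
      IsTrajectory g y₀ L σ r.1 ∧ (∀ s < r.1.t, g (r.1.y s) ≤ g y₀) ∧
      ((r.2 = none ∧ g (r.1.y r.1.t) ≤ g y₀ ∧ ‖∇ g (r.1.y r.1.t)‖ ≤ ε) ∨
        ∃ u v, r.2 = some (u, v) ∧ g u ≤ g y₀ ∧ (∃ j < r.1.t, r.1.x j = v) ∧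
          ¬StronglyConvexAt g σ v u) := by
  have hL : 0 < L := hσ.trans_le hσL
  set T := √(L / σ) * Real.log (2 * L * Δ / ε ^ 2) with hT
  have hT0 : 0 ≤ T := mul_nonneg (Real.sqrt_nonneg _) hlog
  have hK : 0 < √(L / σ) := Real.sqrt_pos.2 (by positivity)
  let Inv : History E → ℕ → Prop := fun h n => n = 2 * h.t ∧ (h.t : ℝ) ≤ T ∧
    IsTrajectory g y₀ L σ h ∧ ∀ s ≤ h.t, g (h.y s) ≤ g y₀
  let Post : History E × Option (E × E) → ℕ → Prop := fun r N => N = 2 * r.1.t ∧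
      (r.1.t : ℝ) ≤ T + 1 ∧
      IsTrajectory g y₀ L σ r.1 ∧ (∀ s < r.1.t, g (r.1.y s) ≤ g y₀) ∧
      ((r.2 = none ∧ g (r.1.y r.1.t) ≤ g y₀ ∧ ‖∇ g (r.1.y r.1.t)‖ ≤ ε) ∨
        ∃ u v, r.2 = some (u, v) ∧ g u ≤ g y₀ ∧ (∃ j < r.1.t, r.1.x j = v) ∧
          ¬StronglyConvexAt g σ v u)
  have hmain := outputs_loop (body := agdBody g y₀ ε L σ) Inv Post (fun h => ⌊T⌋₊ + 1 - h.t)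
    (s := ⟨0, fun _ => y₀, fun _ => y₀, fun _ => 0⟩) ?_ ?_
  · obtain ⟨r, N, hout, rfl, h⟩ := hmain
    exact ⟨r, hout, h⟩
  · rintro h n ⟨rfl, hle, hh, hy⟩
    have hh' := hh.agdStep
    set h' := agdStep L σ h (∇ g (h.x h.t)) with hh'def
    have ht' : h'.t = h.t + 1 := rfl
    have hyold : ∀ s < h'.t, g (h'.y s) ≤ g y₀ := by
      intro s hs
      have hs' : s ≤ h.t := Nat.lt_succ_iff.1 hs
      have : h'.y s = h.y s := by
        simp [hh'def, agdStep, (Nat.lt_succ_of_le hs').ne]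
      rw [this]
      exact hy s hs'
    have htle : (h'.t : ℝ) ≤ T + 1 := by rw [ht']; push_cast; linarith
    rcases hcert : certifyProgress g y₀ (h'.y h'.t) (∇ g (h'.y h'.t)) L σ (L / σ) h'.t with _ | w
    · obtain ⟨c1, c2⟩ := certifyProgress_eq_none hcert
      by_cases hsmall : ‖∇ g (h'.y h'.t)‖ ≤ ε
      · refine ⟨Sum.inl (h', none), 1 + (1 + 0), ?_, Or.inl ⟨_, rfl, ?_⟩⟩
        · refine (outputs_gradEval _ _).bind ((outputs_gradEval _ _).bind ?_)
          simp only [← hh'def]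
          rw [hcert]
          simp only [hsmall, if_true]
          exact outputs_pure _
        · exact ⟨by simp only [ht']; ring, htle, hh', hyold, Or.inl ⟨rfl, c1, hsmall⟩⟩
      · refine ⟨Sum.inr h', 1 + (1 + 0), ?_, Or.inr ⟨_, rfl, ⟨?_, ?_, hh', ?_⟩, ?_⟩⟩
        · refine (outputs_gradEval _ _).bind ((outputs_gradEval _ _).bind ?_)
          simp only [← hh'def]
          rw [hcert]
          simp only [hsmall, if_false]
          exact outputs_pure _
        · rw [ht']; ring
        · have h1 := hΔ (h'.y h'.t - (1 / L) • ∇ g (h'.y h'.t))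
          have h2 : ε ^ 2 < 2 * L * Δ * Real.exp (-(h'.t : ℝ) / √(L / σ)) := by
            refine (pow_lt_pow_left₀ (not_le.1 hsmall) hε.le two_ne_zero).trans_le (c2.trans ?_)
            gcongr
          rw [neg_div, Real.exp_neg, ← div_eq_mul_inv, lt_div_iff₀ (Real.exp_pos _), mul_comm,
            ← lt_div_iff₀ (by positivity)] at h2
          have h3 := (Real.lt_log_iff_exp_lt ((Real.exp_pos _).trans h2)).2 h2
          rw [div_lt_iff₀ hK, mul_comm] at h3
          exact h3.le
        · intro s hs
          rcases hs.lt_or_eq with hs' | rfl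
          · exact hyold s hs'
          · exact c1
        · have := Nat.le_floor hle
          omega
    · obtain ⟨hw, u, v, huv⟩ := exists_witnessPair hh' hσ hσL hdesc hcert
      obtain ⟨hviol, j, hj, hv, hu⟩ := findWitnessPair_eq_some hh' huv
      refine ⟨Sum.inl (h', some (u, v)), 1 + (1 + (0 + 0)), ?_, Or.inl ⟨_, rfl, ?_⟩⟩
      · refine (outputs_gradEval _ _).bind ((outputs_gradEval _ _).bind ?_)
        simp only [← hh'def]
        rw [hcert]
        simp only [huv]
        exact (outputs_ofOption _).bind (outputs_pure _)
      · refine ⟨by simp only [ht']; ring, htle, hh', hyold,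
          Or.inr ⟨u, v, rfl, ?_, ⟨j, hj, hv⟩, hviol⟩⟩
        rcases hu with rfl | rfl
        · exact hyold j hj
        · exact hw
  · refine ⟨rfl, by simpa using hT0, ⟨rfl, rfl, ?_, ?_, ?_⟩, ?_⟩
    all_goals simp

/-! ### Progress of one outer iteration -/

/-- If no iterate among the candidates of `findBestIterate₃` is much better than `p`, then the point
`v = x j` of the witness pair is close to `p` and not much worse than `p`. Since `v` lies on the
line through `y (j - 1)` and `y j`, its value is found by extrapolation. -/
theorem witness_bounds {f : E → ℝ} {p u v : E} {L L₃ α τ : ℝ} {h : History E} (c : Choices E)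
    (hα : 0 < α) (hαL : α ≤ L) (hL₃ : 0 ≤ L₃) (hτ : 0 ≤ τ) (hτL : L₃ * τ ^ 2 ≤ α / 16)
    (hf : HasLipschitzNthDeriv 3 L₃ f) (hh : IsTrajectory (prox f α p) p L α h)
    (hy : ∀ s < h.t, f (h.y s) + α * ‖h.y s - p‖ ^ 2 ≤ f p) (hv : ∃ j < h.t, h.x j = v)
    (hbest : f p - α * τ ^ 2 ≤ f (findBestIterate₃ c f h u v)) :
    ‖v - p‖ ≤ 3 * τ ∧ f v ≤ f p + 14 * (α * τ ^ 2) := by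
  have hατ : 0 ≤ α * τ ^ 2 := by positivity
  have hlist := fun z hz => hbest.trans (c.argmin_le f _ z hz)
  obtain ⟨hj, hxj⟩ := c.index_spec h.x h.t v hv
  set j := c.index h.x h.t v with hjdef
  have hylow : ∀ s < h.t, f p - α * τ ^ 2 ≤ f (h.y s) := fun s hs =>
    hlist _ (List.mem_append_left _ (List.mem_map.2 ⟨s, List.mem_range.2 (by omega), rfl⟩))
  have hclose : ∀ s < h.t, ‖h.y s - p‖ ≤ τ := by
    intro s hs
    have h1 : α * ‖h.y s - p‖ ^ 2 ≤ α * τ ^ 2 := by linarith [hylow s hs, hy s hs]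
    exact (sq_le_sq₀ (norm_nonneg _) hτ).1 (le_of_mul_le_mul_left h1 hα)
  have hyup : ∀ s < h.t, f (h.y s) ≤ f p := by
    intro s hs
    have : 0 ≤ α * ‖h.y s - p‖ ^ 2 := by positivity
    linarith [hy s hs]
  rcases hj0 : j with _ | i
  · rw [hj0, hh.x_zero] at hxj
    rw [← hxj]
    simp only [sub_self, norm_zero]
    constructor <;> linarith
  · have hi : i + 1 < h.t := hj0 ▸ hj
    have hi' : i < h.t := by omega
    have hjpos : 0 < j := by omega
    have hji : j - 1 = i := by omega
    set ω := (√(L / α) - 1) / (√(L / α) + 1) with hω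
    have hK1 : 1 ≤ √(L / α) := by rw [Real.one_le_sqrt, le_div_iff₀ hα]; linarith
    have hω0 : 0 ≤ ω := div_nonneg (by linarith) (by linarith)
    have hω1 : ω ≤ 1 := by rw [hω, div_le_one (by linarith)]; linarith
    set s : E := h.y (i + 1) - h.y i with hs
    have hvs : v = h.y i + (1 + ω) • s := by
      rw [← hxj, hj0, hh.x_succ i hi', ← hω, hs]
      module
    have hsn : ‖s‖ ≤ 2 * τ := by
      have : s = (h.y (i + 1) - p) - (h.y i - p) := by rw [hs]; module
      rw [this]
      exact (norm_sub_le _ _).trans (by linarith [hclose i hi', hclose (i + 1) hi])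
    constructor
    · have : v - p = (h.y (i + 1) - p) + ω • s := by rw [hvs, hs]; module
      rw [this]
      refine (norm_add_le _ _).trans ?_
      rw [norm_smul, Real.norm_eq_abs, abs_of_nonneg hω0]
      nlinarith [hclose (i + 1) hi, norm_nonneg s]
    · have hcj : f p - α * τ ^ 2 ≤ f (h.y i + (1 / 2 : ℝ) • s) := by
        have e : h.y i + (1 / 2 : ℝ) • s = (1 / 2 : ℝ) • (h.y j + h.y (j - 1)) := by
          rw [hs, hji, hj0]; module
        rw [e]
        exact hlist _ (List.mem_append_right _ (by simp [hjpos]))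
      have hqj : f p - α * τ ^ 2 ≤ f (h.y i + (-2 : ℝ) • s) := by
        have e : h.y i + (-2 : ℝ) • s = (-2 : ℝ) • h.y j + (3 : ℝ) • h.y (j - 1) := by
          rw [hs, hji, hj0]; module
        rw [e]
        exact hlist _ (List.mem_append_right _ (by simp [hjpos]))
      have hext := hf.extrapolation_le hL₃ (h.y i) s hατ hω0 hω1 (hyup i hi')
        (by rw [hs, add_sub_cancel]; exact hyup (i + 1) hi) hcj hqj
      rw [← hvs] at hext
      have hs4 : ‖s‖ ^ 4 ≤ (2 * τ) ^ 4 := pow_le_pow_left₀ (norm_nonneg _) hsn 4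
      have e1 : 7 / 12 * L₃ * ‖s‖ ^ 4 ≤ 7 / 12 * L₃ * (2 * τ) ^ 4 :=
        mul_le_mul_of_nonneg_left hs4 (by positivity)
      have e2 : L₃ * τ ^ 2 * τ ^ 2 ≤ α / 16 * τ ^ 2 :=
        mul_le_mul_of_nonneg_right hτL (sq_nonneg τ)
      have e3 : 7 / 12 * L₃ * (2 * τ) ^ 4 = 28 / 3 * (L₃ * τ ^ 2 * τ ^ 2) := by ring
      linarith

/-- The progress of an outer iteration in which a violation of convexity was found. The length
`τ = √(α / (32 * L₃))` is an eighth of the step `η`: this puts `u` and `v` within `η / 2`, and makes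
the decrease `α * η ^ 2 / 4` outweigh the possible increase from `p` to `v`. -/
theorem nextIterate_progress_of_pair {f : E → ℝ} {p u v : E} {L L₃ α : ℝ} {h : History E}
    (c : Choices E) (hα : 0 < α) (hαL : α ≤ L) (hL₃ : 0 < L₃) (hf : HasLipschitzNthDeriv 3 L₃ f)
    (hh : IsTrajectory (prox f α p) p L α h)
    (hy : ∀ s < h.t, f (h.y s) + α * ‖h.y s - p‖ ^ 2 ≤ f p)
    (hu : f u + α * ‖u - p‖ ^ 2 ≤ f p) (hv : ∃ j < h.t, h.x j = v)
    (huv : ¬StronglyConvexAt (prox f α p) α v u) :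
    f (nextIterate c f √(2 * α / L₃) (h, some (u, v))) ≤ f p - α ^ 2 / (32 * L₃) := by
  set η := √(2 * α / L₃) with hη
  set b₁ := findBestIterate₃ c f h u v with hb₁
  set b₂ := exploitNCPair₃ c f u v η with hb₂
  have hn : nextIterate c f η (h, some (u, v)) = c.argmin f [b₁, b₂] := rfl
  have hle₁ : f (c.argmin f [b₁, b₂]) ≤ f b₁ := c.argmin_le f _ _ (by simp)
  have hle₂ : f (c.argmin f [b₁, b₂]) ≤ f b₂ := c.argmin_le f _ _ (by simp)
  rw [hn]
  set τ := √(α / (32 * L₃)) with hτ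
  have hτ0 : 0 ≤ τ := Real.sqrt_nonneg _
  have hτ2 : τ ^ 2 = α / (32 * L₃) := Real.sq_sqrt (by positivity)
  have hατ : α * τ ^ 2 = α ^ 2 / (32 * L₃) := by rw [hτ2]; ring
  rw [← hατ]
  by_contra! hcon
  have hbest : f p - α * τ ^ 2 ≤ f b₁ := by linarith
  obtain ⟨hvp, hfv⟩ := witness_bounds c hα hαL hL₃.le hτ0 (by rw [hτ2]; field_simp; norm_num)
    hf hh hy hv hbest
  have hub : f b₁ ≤ f u := c.argmin_le f _ _ (by simp)
  have hup : ‖u - p‖ ≤ τ := by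
    have h1 : α * ‖u - p‖ ^ 2 ≤ α * τ ^ 2 := by linarith
    exact (sq_le_sq₀ (norm_nonneg _) hτ0).1 (le_of_mul_le_mul_left h1 hα)
  have hη2 : η ^ 2 = 2 * α / L₃ := Real.sq_sqrt (by positivity)
  have hη0 : 0 < η := Real.sqrt_pos.2 (by positivity)
  have hητ : η = 8 * τ := by
    rw [← sq_eq_sq₀ hη0.le (by positivity), mul_pow, hτ2, hη2]
    field_simp
    norm_num
  have hr : ‖u - v‖ ≤ η / 2 := by
    have : u - v = (u - p) - (v - p) := by module
    rw [this]
    exact (norm_sub_le _ _).trans (by linarith)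
  have hnc : f u < f v + inner ℝ (∇ f v) (u - v) - α / 2 * ‖u - v‖ ^ 2 := by
    have e : ‖u - p‖ ^ 2 = ‖v - p‖ ^ 2 + 2 * inner ℝ (v - p) (u - v) + ‖u - v‖ ^ 2 := by
      rw [← norm_add_sq_real]
      congr 2
      module
    rw [StronglyConvexAt, not_le, gradient_prox (hf.differentiable (by norm_num))] at huv
    simp only [prox, e, inner_add_left, real_inner_smul_left] at huv
    linarith
  have hdec := exploit_negative_curvature hα hη0 (by rw [hη2]; field_simp) hf hr hnc
  have hq₁ : f b₂ ≤ f (v - η • (1 / ‖u - v‖) • (u - v)) := c.argmin_le f _ _ (by simp)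
  have hq₂ : f b₂ ≤ f (u + (√(η * (η + ‖u - v‖)) - ‖u - v‖) • (1 / ‖u - v‖) • (u - v)) :=
    c.argmin_le f _ _ (by simp)
  have hfu : f u ≤ f p := by
    have : 0 ≤ α * ‖u - p‖ ^ 2 := by positivity
    linarith
  have e1 : α / 4 * η ^ 2 = 16 * (α * τ ^ 2) := by rw [hητ]; ring
  have e2 : α / 12 * η ^ 2 = 16 / 3 * (α * τ ^ 2) := by rw [hητ]; ring
  have hατ0 : 0 ≤ α * τ ^ 2 := by positivity
  rcases hdec with hdec | hdec <;> linarith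

/-- The progress of an outer iteration in which the proximal problem was solved: if the gradient of
`f` is still large, then the proximal term must have moved the iterate far from `p`. -/
theorem progress_of_large_gradient {f : E → ℝ} {p y : E} {α ε : ℝ} (hα : 0 < α) (hε : 0 < ε)
    (hf : Differentiable ℝ f) (hy : f y + α * ‖y - p‖ ^ 2 ≤ f p)
    (hsmall : ‖∇ (prox f α p) y‖ ≤ ε / 10) (hlarge : ε < ‖∇ f y‖) :
    f y ≤ f p - ε ^ 2 / (5 * α) := by
  rw [gradient_prox hf] at hsmall
  have h1 : ‖∇ f y‖ ≤ ‖∇ f y + (2 * α) • (y - p)‖ + 2 * α * ‖y - p‖ := by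
    have := norm_sub_le (∇ f y + (2 * α) • (y - p)) ((2 * α) • (y - p))
    rwa [add_sub_cancel_right, norm_smul, Real.norm_eq_abs, abs_of_pos (by positivity)] at this
  have h2 : 9 / 20 * ε ≤ α * ‖y - p‖ := by linarith
  have h3 : (9 / 20 * ε) ^ 2 ≤ (α * ‖y - p‖) ^ 2 := pow_le_pow_left₀ (by positivity) h2 2
  have h4 : ε ^ 2 / (5 * α) ≤ α * ‖y - p‖ ^ 2 := by
    rw [div_le_iff₀ (by positivity)]
    nlinarith
  linarith

/-! ### Complexity of the outer method -/

/-- One outer iteration: its cost, and its progress unless the stopping test succeeds. -/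
theorem outerBody_outputs {f : E → ℝ} {p : E} {L₁ L₃ α ε Δ D : ℝ} (c : Choices E)
    (hL₁ : 0 < L₁) (hL₃ : 0 < L₃) (hα : 0 < α) (hε : 0 < ε)
    (hf₁ : HasLipschitzNthDeriv 1 L₁ f) (hf₃ : HasLipschitzNthDeriv 3 L₃ f)
    (hΔ : ∀ z, f p - f z ≤ Δ)
    (hlog : 0 ≤ Real.log (2 * (L₁ + 2 * α) * Δ / (ε / 10) ^ 2))
    (hD₁ : D ≤ ε ^ 2 / (5 * α)) (hD₂ : D ≤ α ^ 2 / (32 * L₃)) :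
    ∃ (q : E) (o : E ⊕ E) (m : ℕ), (outerBody c f L₁ ε α √(2 * α / L₃) p).Outputs o m ∧
      (m : ℝ) ≤ 2 * (√((L₁ + 2 * α) / α) *
        Real.log (2 * (L₁ + 2 * α) * Δ / (ε / 10) ^ 2) + 1) + 1 ∧
      ((o = Sum.inl q ∧ ‖∇ f q‖ ≤ ε) ∨ (o = Sum.inr q ∧ f q ≤ f p - D)) := by
  have hprox : ∀ x, prox f α p x = f x + α * ‖x - p‖ ^ 2 := fun x => rfl
  have hproxp : prox f α p p = f p := by simp [prox]
  obtain ⟨⟨h, w⟩, hout, ht, hh, hy, hres⟩ := agdUntilProvenGuilty_outputs (g := prox f α p)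
    (y₀ := p) (ε := ε / 10) (L := L₁ + 2 * α) (σ := α) (Δ := Δ) (by positivity) hα (by linarith)
    (prox_gradient_step hf₁ (by linarith) p)
    (fun z => by
      have h1 := hΔ z
      have h2 : 0 ≤ α / 2 * ‖z - p‖ ^ 2 := by positivity
      rw [hproxp, hprox]
      linarith) hlog
  simp only [hproxp, hprox] at hy hres
  set q := nextIterate c f √(2 * α / L₃) (h, w) with hq
  have hprog : ε < ‖∇ f q‖ → f q ≤ f p - D := by
    intro hlarge
    rcases hres with ⟨rfl, h1, h2⟩ | ⟨u, v, rfl, hu, hv, huv⟩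
    · exact (progress_of_large_gradient hα hε (hf₁.differentiable one_pos) h1 h2 hlarge).trans
        (by linarith)
    · exact (nextIterate_progress_of_pair c hα (by linarith) hL₃ hf₃ hh hy hu hv huv).trans
        (by linarith)
  by_cases hsmall : ‖∇ f q‖ ≤ ε
  · refine ⟨q, Sum.inl q, 2 * h.t + (1 + 0), hout.bind ((outputs_gradEval f q).bind ?_), ?_,
      Or.inl ⟨rfl, hsmall⟩⟩
    · simp only [← hq, hsmall, if_true]
      exact outputs_pure _
    · push_cast
      linarith
  · refine ⟨q, Sum.inr q, 2 * h.t + (1 + 0), hout.bind ((outputs_gradEval f q).bind ?_), ?_,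
      Or.inr ⟨rfl, hprog (not_le.1 hsmall)⟩⟩
    · simp only [← hq, hsmall, if_false]
      exact outputs_pure _
    · push_cast
      linarith

theorem guardedNonConvexAGD₃_outputs {f : E → ℝ} {p₀ : E} {L₁ L₃ α ε Δ D : ℝ} (c : Choices E)
    (hL₁ : 0 < L₁) (hL₃ : 0 < L₃) (hα : 0 < α) (hε : 0 < ε)
    (hf₁ : HasLipschitzNthDeriv 1 L₁ f) (hf₃ : HasLipschitzNthDeriv 3 L₃ f)
    (hΔ : ∀ z, f p₀ - f z ≤ Δ)
    (hlog : 0 ≤ Real.log (2 * (L₁ + 2 * α) * Δ / (ε / 10) ^ 2))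
    (hD : 0 < D) (hD₁ : D ≤ ε ^ 2 / (5 * α)) (hD₂ : D ≤ α ^ 2 / (32 * L₃)) :
    ∃ (pK : E) (N : ℕ), (guardedNonConvexAGD₃ c f p₀ L₁ ε α √(2 * α / L₃)).Outputs pK N ∧
      ‖∇ f pK‖ ≤ ε ∧
      (N : ℝ) ≤ (Δ / D + 1) * (2 * (√((L₁ + 2 * α) / α) *
        Real.log (2 * (L₁ + 2 * α) * Δ / (ε / 10) ^ 2) + 1) + 1) := by
  set C := 2 * (√((L₁ + 2 * α) / α) *
        Real.log (2 * (L₁ + 2 * α) * Δ / (ε / 10) ^ 2) + 1) + 1 with hC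
  have hC0 : 0 ≤ C := by
    have := mul_nonneg (Real.sqrt_nonneg ((L₁ + 2 * α) / α)) hlog
    linarith
  let Inv : E → ℕ → Prop := fun p n => ∃ k : ℕ, (n : ℝ) ≤ k * C ∧ f p ≤ f p₀ - k * D
  let Post : E → ℕ → Prop := fun p N => ‖∇ f p‖ ≤ ε ∧ (N : ℝ) ≤ (Δ / D + 1) * C
  refine outputs_loop Inv Post (fun p => ⌊(f p - f p₀ + Δ) / D⌋₊) ?_ ⟨0, by simp, by simp⟩
  rintro p n ⟨k, hn, hk⟩
  have hkD : (k : ℝ) ≤ Δ / D := by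
    rw [le_div_iff₀ hD]
    linarith [hΔ p]
  have hkD0 : 0 ≤ (k : ℝ) * D := by positivity
  obtain ⟨q, o, m, hout, hm, ⟨rfl, hgrad⟩ | ⟨rfl, hdec⟩⟩ := outerBody_outputs c hL₁ hL₃ hα hε hf₁
    hf₃ (fun z => by linarith [hΔ z]) hlog hD₁ hD₂ (p := p)
  · refine ⟨_, m, hout, Or.inl ⟨q, rfl, hgrad, ?_⟩⟩
    have := mul_le_mul_of_nonneg_right hkD hC0
    push_cast
    linarith
  · refine ⟨_, m, hout, Or.inr ⟨q, rfl, ⟨k + 1, ?_, ?_⟩, ?_⟩⟩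
    · push_cast
      linarith
    · push_cast
      linarith
    · have h1 : (f q - f p₀ + Δ) / D + 1 ≤ (f p - f p₀ + Δ) / D := by
        rw [div_add_one hD.ne']
        exact div_le_div_of_nonneg_right (by linarith) hD.le
      have h2 : 0 ≤ (f q - f p₀ + Δ) / D := div_nonneg (by linarith [hΔ q]) hD.le
      have h3 := Nat.floor_mono h1
      rw [Nat.floor_add_one h2] at h3
      exact h3

/-- The constants. Here `a`, `e`, `l` stand for `L₃ ^ (1/6)`, `ε ^ (1/3)`, `L₁ ^ (1/2)`, so that
`α = 2 * a ^ 2 * e ^ 2` and `l / (a * e)` is `√(2 * L₁ / α)`. That `200 * (1 + 2 * α / L₁) ≤ 300` is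
less than `500` under the logarithm absorbs a large part of the additive terms. -/
theorem complexity_bound {a e l Δ : ℝ} (ha : 0 < a) (he : 0 < e) (hl : 0 < l)
    (hΔ : e ^ 4 ≤ Δ * a ^ 2) (hle : 8 * a ^ 2 * e ^ 2 ≤ l ^ 2) :
    0 ≤ Real.log (2 * (l ^ 2 + 2 * (2 * a ^ 2 * e ^ 2)) * Δ / (e ^ 3 / 10) ^ 2) ∧
    (Δ / (e ^ 4 / (10 * a ^ 2)) + 1) *
      (2 * (√((l ^ 2 + 2 * (2 * a ^ 2 * e ^ 2)) / (2 * a ^ 2 * e ^ 2)) *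
        Real.log (2 * (l ^ 2 + 2 * (2 * a ^ 2 * e ^ 2)) * Δ / (e ^ 3 / 10) ^ 2) + 1) + 1) ≤
      20 * (Δ * l * a / e ^ 5) * Real.log (500 * l ^ 2 * Δ / (e ^ 3) ^ 2) := by
  have hΔ0 : 0 < Δ := pos_of_mul_pos_left ((pow_pos he 4).trans_le hΔ) (by positivity)
  -- `B` is the ratio of `L₁ * Δ` to `ε ^ 2`
  set B := l ^ 2 * Δ / e ^ 6 with hB
  have hB8 : 8 ≤ B := by
    rw [hB, le_div_iff₀ (by positivity)]
    have h1 := mul_le_mul_of_nonneg_right hle hΔ0.le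
    have h2 := mul_le_mul_of_nonneg_left hΔ (show 0 ≤ 8 * e ^ 2 by positivity)
    linarith
  have hα : l ^ 2 + 2 * (2 * a ^ 2 * e ^ 2) ≤ 3 / 2 * l ^ 2 := by linarith
  have hup : 2 * (l ^ 2 + 2 * (2 * a ^ 2 * e ^ 2)) * Δ / (e ^ 3 / 10) ^ 2 ≤ 300 * B := by
    rw [hB, div_le_iff₀ (by positivity)]
    have h1 := mul_le_mul_of_nonneg_right hα hΔ0.le
    have : 300 * (l ^ 2 * Δ / e ^ 6) * (e ^ 3 / 10) ^ 2 = 3 * l ^ 2 * Δ := by field_simp; norm_num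
    rw [this]
    linarith
  have hlow : 200 * B ≤ 2 * (l ^ 2 + 2 * (2 * a ^ 2 * e ^ 2)) * Δ / (e ^ 3 / 10) ^ 2 := by
    rw [hB, le_div_iff₀ (by positivity)]
    have : 200 * (l ^ 2 * Δ / e ^ 6) * (e ^ 3 / 10) ^ 2 = 2 * l ^ 2 * Δ := by field_simp; norm_num
    rw [this]
    have : 0 ≤ 2 * (2 * (2 * a ^ 2 * e ^ 2)) * Δ := by positivity
    linarith
  have hlog0 : 0 ≤ Real.log (2 * (l ^ 2 + 2 * (2 * a ^ 2 * e ^ 2)) * Δ / (e ^ 3 / 10) ^ 2) :=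
    Real.log_nonneg (by linarith)
  refine ⟨hlog0, ?_⟩
  have hB500 : 500 * l ^ 2 * Δ / (e ^ 3) ^ 2 = 500 * B := by rw [hB]; ring
  rw [hB500]
  set ℓ := Real.log (500 * B) with hℓ
  set ℓ' := Real.log (2 * (l ^ 2 + 2 * (2 * a ^ 2 * e ^ 2)) * Δ / (e ^ 3 / 10) ^ 2) with hℓ'
  -- the gap between `300` and `500`
  have hℓ'le : ℓ' ≤ ℓ - 2 / 5 := by
    have h1 : ℓ' ≤ Real.log (300 * B) := Real.log_le_log (by linarith) hup
    have h2 : Real.log (300 * B) = Real.log (3 / 5) + ℓ := by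
      rw [hℓ, ← Real.log_mul (by norm_num) (by linarith)]
      ring_nf
    have h3 := Real.log_le_sub_one_of_pos (show (0 : ℝ) < 3 / 5 by norm_num)
    linarith
  have hℓge : 6 ≤ ℓ := by
    have h1 : Real.log (2 ^ 10) ≤ ℓ := Real.log_le_log (by norm_num) (by linarith)
    rw [Real.log_pow] at h1
    have := Real.log_two_gt_d9
    push_cast at h1
    linarith
  set X := l / (a * e) with hX
  have hX0 : 0 < X := by positivity
  have hX2 : X ^ 2 = l ^ 2 / (a ^ 2 * e ^ 2) := by rw [hX, div_pow, mul_pow]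
  have hX8 : 8 ≤ X ^ 2 := by rw [hX2, le_div_iff₀ (by positivity)]; linarith
  have hX3 : 3 ≤ 107 / 100 * X := by nlinarith
  have hsqrt : √((l ^ 2 + 2 * (2 * a ^ 2 * e ^ 2)) / (2 * a ^ 2 * e ^ 2)) ≤ 8661 / 10000 * X := by
    refine Real.sqrt_le_iff.2 ⟨by positivity, ?_⟩
    have h1 : (l ^ 2 + 2 * (2 * a ^ 2 * e ^ 2)) / (2 * a ^ 2 * e ^ 2) ≤ 3 / 4 * X ^ 2 := by
      rw [hX2, div_le_iff₀ (by positivity)]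
      have : 3 / 4 * (l ^ 2 / (a ^ 2 * e ^ 2)) * (2 * a ^ 2 * e ^ 2) = 3 / 2 * l ^ 2 := by
        field_simp; norm_num
      rw [this]
      exact hα
    nlinarith
  have hC : 2 * (√((l ^ 2 + 2 * (2 * a ^ 2 * e ^ 2)) / (2 * a ^ 2 * e ^ 2)) * ℓ' + 1) + 1 ≤
      20 / 11 * (X * ℓ) := by
    have h1 := mul_le_mul hsqrt hℓ'le hlog0 (by positivity)
    have h2 := mul_le_mul_of_nonneg_left hℓge hX0.le
    linarith
  have hK : Δ / (e ^ 4 / (10 * a ^ 2)) + 1 ≤ 11 * (Δ * a ^ 2 / e ^ 4) := by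
    have h1 : 1 ≤ Δ * a ^ 2 / e ^ 4 := by rw [le_div_iff₀ (by positivity)]; linarith
    have h2 : Δ / (e ^ 4 / (10 * a ^ 2)) = 10 * (Δ * a ^ 2 / e ^ 4) := by field_simp
    linarith
  refine (mul_le_mul hK hC (by positivity) (by positivity)).trans_eq ?_
  rw [hX]
  field_simp

end GuiltyAGD

theorem theorem2 (d : ℕ) (f : EuclideanSpace ℝ (Fin d) → ℝ) (L₁ L₃ : ℝ)
    (hL₁ : 0 < L₁) (hL₃ : 0 < L₃)
    (hf₁ : GuiltyAGD.HasLipschitzNthDeriv 1 L₁ f)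
    (hf₃ : GuiltyAGD.HasLipschitzNthDeriv 3 L₃ f)
    (hbdd : BddBelow (Set.range f))
    (p₀ : EuclideanSpace ℝ (Fin d)) (Δf : ℝ) (hΔf : Δf = f p₀ - ⨅ z, f z)
    (ε : ℝ) (hε : 0 < ε)
    (hε_le : ε ^ (2 / 3 : ℝ) ≤
      min (Δf ^ (1 / 2 : ℝ) * L₃ ^ (1 / 6 : ℝ)) (L₁ / (8 * L₃ ^ (1 / 3 : ℝ))))
    (α : ℝ) (hα : α = 2 * L₃ ^ (1 / 3 : ℝ) * ε ^ (2 / 3 : ℝ))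
    (c : GuiltyAGD.Choices (EuclideanSpace ℝ (Fin d))) :
    ∃ (pK : EuclideanSpace ℝ (Fin d)) (N : ℕ),
      (GuiltyAGD.guardedNonConvexAGD₃ c f p₀ L₁ ε α (√(2 * α / L₃))).Outputs pK N ∧
      ‖gradient f pK‖ ≤ ε ∧
      (N : ℝ) ≤ 20 * (Δf * L₁ ^ (1 / 2 : ℝ) * L₃ ^ (1 / 6 : ℝ) / ε ^ (5 / 3 : ℝ)) *
        Real.log (500 * L₁ * Δf / ε ^ 2) := by
  have hrpow : ∀ {x : ℝ}, 0 < x → ∀ (r : ℝ) (n : ℕ), (x ^ r) ^ n = x ^ (r * n) := fun hx r n => by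
    rw [Real.rpow_mul hx.le, Real.rpow_natCast]
  obtain ⟨a, ha⟩ : ∃ a, a = L₃ ^ (1 / 6 : ℝ) := ⟨_, rfl⟩
  obtain ⟨e, he⟩ : ∃ e, e = ε ^ (1 / 3 : ℝ) := ⟨_, rfl⟩
  obtain ⟨l, hl⟩ : ∃ l, l = L₁ ^ (1 / 2 : ℝ) := ⟨_, rfl⟩
  have ha0 : 0 < a := ha ▸ Real.rpow_pos_of_pos hL₃ _
  have he0 : 0 < e := he ▸ Real.rpow_pos_of_pos hε _
  have hl0 : 0 < l := hl ▸ Real.rpow_pos_of_pos hL₁ _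
  have ha2 : L₃ ^ (1 / 3 : ℝ) = a ^ 2 := by rw [ha, hrpow hL₃]; norm_num
  have ha6 : L₃ = a ^ 6 := by rw [ha, hrpow hL₃]; norm_num
  have he2 : ε ^ (2 / 3 : ℝ) = e ^ 2 := by rw [he, hrpow hε]; norm_num
  have he3 : ε = e ^ 3 := by rw [he, hrpow hε]; norm_num
  have he5 : ε ^ (5 / 3 : ℝ) = e ^ 5 := by rw [he, hrpow hε]; norm_num
  have hl2 : L₁ = l ^ 2 := by rw [hl, hrpow hL₁]; norm_num
  have hΔ : ∀ z, f p₀ - f z ≤ Δf := fun z => by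
    rw [hΔf]
    linarith [ciInf_le hbdd z]
  have hΔ0 : 0 ≤ Δf := by simpa using hΔ p₀
  rw [← ha, he2, ha2] at hε_le
  obtain ⟨hε₁, hε₂⟩ := le_min_iff.1 hε_le
  have h4 : e ^ 4 ≤ Δf * a ^ 2 := by
    have h1 := pow_le_pow_left₀ (by positivity) hε₁ 2
    rw [mul_pow, ← Real.sqrt_eq_rpow, Real.sq_sqrt hΔ0] at h1
    linarith
  have h8 : 8 * a ^ 2 * e ^ 2 ≤ l ^ 2 := by
    rw [le_div_iff₀ (by positivity), hl2] at hε₂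
    linarith
  obtain ⟨hlog, hbound⟩ := GuiltyAGD.complexity_bound ha0 he0 hl0 h4 h8
  rw [ha2, he2] at hα
  have hα0 : 0 < α := hα ▸ by positivity
  rw [← hα, ← hl2, ← he3] at hlog hbound
  have hD : 0 < e ^ 4 / (10 * a ^ 2) := by positivity
  obtain ⟨pK, N, hout, hgrad, hN⟩ := GuiltyAGD.guardedNonConvexAGD₃_outputs
    (D := e ^ 4 / (10 * a ^ 2)) c hL₁ hL₃ hα0 hε hf₁ hf₃ hΔ hlog hD
    (by rw [hα, he3]; apply le_of_eq; field_simp; norm_num)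
    (by
      have : α ^ 2 / (32 * L₃) = e ^ 4 / (8 * a ^ 2) := by rw [hα, ha6]; field_simp; norm_num
      rw [this]
      gcongr
      norm_num)
  refine ⟨pK, N, hout, hgrad, hN.trans ?_⟩
  rw [he5, ← ha, ← hl]
  exact hbound
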